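/- Let $\Delta$ be an acute triangle in the Euclidean plane. A \emph{schedule} for $\Delta$ is an infinite sequence $S=\{s_i\}_{i\ge 0}$ of points, each lying on an edge of $\Delta$ (edges are closed segments). An edge $\delta$ is \emph{visited} at step $i$ if $s_i\in\delta$; in particular, a vertex visits both incident edges. The schedule is \emph{feasible} if every edge is visited infinitely often. The time between steps $i<j$ is $\sum_{m=i}^{j-1}|s_ms_{m+1}|$. The \emph{$1$-gap} of an edge is the supremum (in $[0,\infty]$) of the times between its consecutive visitations, and the $1$-gap $G(S)$ of $S$ is the maximum of the $1$-gaps of the three edges. A schedule is \emph{cyclic} if one can choose for every $i$ an edge $e(s_i)$ containing $s_i$ such that $e(s_0),e(s_1),e(s_2)$ are the three edges of $\Delta$ in some order and $e(s_{i+3})=e(s_i)$ for all $i\ge 0$; it is \emph{$3$-periodic} if $s_{i+3}=s_i$ for all $i\ge 0$. \textbf{Theorem.} Let $K,L,M$ be the feet of the altitudes of $\Delta$. The orthic schedule $O=(K,L,M,K,L,M,\dots)$ is a feasible, cyclic and $3$-periodic schedule, its $1$-gap $G(O)$ equals the perimeter $|KL|+|LM|+|MK|$ of the orthic triangle, and it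 is $1$-gap optimal among all feasible schedules, cyclic or not: $G(O)\le G(S)$ for every feasible schedule $S$ for $\Delta$. -/

import Mathlib

open scoped ENNReal

noncomputable section

namespace Patrolling

/-- The Euclidean plane. -/
abbrev Plane : Type := EuclideanSpace ℝ (Fin 2)

/-- The edge of the triangle `Δ` opposite to its vertex number `i`: the closed segment between the
two other vertices (indices are added modulo 3). -/
def edge (Δ : Affine.Triangle ℝ Plane) (i : Fin 3) : Set Plane :=
  segment ℝ (Δ.points (i + 1)) (Δ.points (i + 2))

/-- A patrolling schedule: an infinite sequence of points on the edges of the triangle. -/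
def IsSchedule (Δ : Affine.Triangle ℝ Plane) (s : ℕ → Plane) : Prop :=
  ∀ i, ∃ δ, s i ∈ edge Δ δ

/-- Step `i` of the sequence `s` visits the edge `δ` if the point `s i` lies on it. In particular a
vertex visits both edges incident to it. -/
def Visits (Δ : Affine.Triangle ℝ Plane) (s : ℕ → Plane) (δ : Fin 3) (i : ℕ) : Prop :=
  s i ∈ edge Δ δ

/-- A feasible schedule: a schedule that visits every edge infinitely often. -/
def IsFeasible (Δ : Affine.Triangle ℝ Plane) (s : ℕ → Plane) : Prop :=
  IsSchedule Δ s ∧ ∀ δ : Fin 3, ∀ k : ℕ, ∃ l, k ≤ l ∧ Visits Δ s δ l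

/-- A cyclic schedule: the visited edges can be listed as a 3-periodic sequence whose first three
entries are the three edges in some order. -/
def IsCyclic (Δ : Affine.Triangle ℝ Plane) (s : ℕ → Plane) : Prop :=
  ∃ e : ℕ → Fin 3, (∀ i, Visits Δ s (e i) i) ∧
    ({e 0, e 1, e 2} : Set (Fin 3)) = Set.univ ∧ ∀ i, e (i + 3) = e i

/-- A `k`-periodic sequence of points. -/
def IsPeriodic (k : ℕ) (s : ℕ → Plane) : Prop :=
  ∀ i, s (i + k) = s i

/-- The time a unit speed agent needs to follow the sequence `s` from step `i` to step `j`. -/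
def travelTime (s : ℕ → Plane) (i j : ℕ) : ℝ≥0∞ :=
  ∑ m ∈ Finset.Ico i j, edist (s m) (s (m + 1))

/-- The `t`-gap sequence of the edge `δ`: its `k`-th element is the time between the `k`-th and the
`(k + t)`-th visitation of `δ` (counted from `0`). -/
def gapSeq (Δ : Affine.Triangle ℝ Plane) (s : ℕ → Plane) (t : ℕ) (δ : Fin 3) (k : ℕ) : ℝ≥0∞ :=
  travelTime s (Nat.nth (Visits Δ s δ) k) (Nat.nth (Visits Δ s δ) (k + t))

/-- The `t`-gap of an edge: the supremum (possibly infinite) of its `t`-gap sequence. -/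
def edgeGap (Δ : Affine.Triangle ℝ Plane) (s : ℕ → Plane) (t : ℕ) (δ : Fin 3) : ℝ≥0∞ :=
  ⨆ k, gapSeq Δ s t δ k

/-- The `t`-gap of a schedule: the largest of the `t`-gaps of the three edges. -/
def gap (Δ : Affine.Triangle ℝ Plane) (s : ℕ → Plane) (t : ℕ) : ℝ≥0∞ :=
  ⨆ δ : Fin 3, edgeGap Δ s t δ

/-- The orthic schedule: the feet of the three altitudes are visited periodically, in the order
`0, 1, 2, 0, 1, 2, …`. -/
def orthicSchedule (Δ : Affine.Triangle ℝ Plane) (i : ℕ) : Plane :=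
  Δ.altitudeFoot (Fin.ofNat 3 i)

/-- The perimeter of the orthic triangle. -/
def orthicPerimeter (Δ : Affine.Triangle ℝ Plane) : ℝ :=
  dist (Δ.altitudeFoot 0) (Δ.altitudeFoot 1) + dist (Δ.altitudeFoot 1) (Δ.altitudeFoot 2) +
    dist (Δ.altitudeFoot 2) (Δ.altitudeFoot 0)

end Patrolling

end

/-! Write P for `orthicLength`, the sum of a cos A over the sides, and suppose that some feasible
schedule has all times between consecutive visits at most G < P. Cyclic case
(`orthicLength_le_of_cyclic`). The unit vectors `flow V k` along the orthic sides obey the law of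
reflection: `flow V k` and `flow V (k + 1)` have the same component along the edge k + 1. Projecting
each leg onto its flow therefore telescopes: three legs cost at least P plus the net change of
`phase`. Without movement along edges, the phase would drop by P - G at every return, although it is
nonnegative. Movement along the edge k gains phase only at rate `cosAt V k` < 1, and it also
lengthens the return times of the two other edges; a potential with weights 1 - cos absorbs it,
because the cosines sum to at most 2. General case (`orthicLength_le_of_gap_le`). A path through
three different edges has length at least P/2 (`orthicLength_le_of_ne`). Going from a to b and back
to a without meeting c puts c, a, b, a, c between consecutive visits of c, which costs at least P.
So the schedule eventually keeps one direction of rotation, and a relabelling of the vertices gives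
the cyclic case. For the orthic schedule itself, the legs have lengths a cos A (`dist_foot_foot`)
and every edge is revisited within three steps. -/

open scoped RealInnerProductSpace EuclideanGeometry

/-! ### Sides, cosines and the orthic directions. -/

namespace Patrolling

section Geometry

variable {E : Type*} [NormedAddCommGroup E] [InnerProductSpace ℝ E]

/-- The length of the edge opposite to the vertex `k`. -/
noncomputable def side (V : Fin 3 → E) (k : Fin 3) : ℝ :=
  dist (V (k + 1)) (V (k + 2))

/-- The cosine of the angle at the vertex `k`. -/
noncomputable def cosAt (V : Fin 3 → E) (k : Fin 3) : ℝ :=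
  Real.cos (∠ (V (k + 1)) (V k) (V (k + 2)))

/-- A nondegenerate acute triangle. -/
structure IsAcute (V : Fin 3 → E) : Prop where
  side_pos : ∀ k, 0 < side V k
  cosAt_pos : ∀ k, 0 < cosAt V k
  cosAt_lt_one : ∀ k, cosAt V k < 1

/-- The direction of the orthic side that leads from the edge `k` to the edge `k + 1`. -/
noncomputable def flow (V : Fin 3 → E) (k : Fin 3) : E :=
  (side V (k + 2))⁻¹ • ((side V k / side V (k + 1)) • (V k - V (k + 2)) -
    (side V (k + 1) / side V k) • (V (k + 1) - V (k + 2)))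

/-- The perimeter of the orthic triangle, in terms of sides and angles. -/
noncomputable def orthicLength (V : Fin 3 → E) : ℝ :=
  ∑ k, side V k * cosAt V k

lemma fin3_add_one_add_one (k : Fin 3) : k + 1 + 1 = k + 2 := by omega
lemma fin3_add_one_add_two (k : Fin 3) : k + 1 + 2 = k := by omega
lemma fin3_add_two_add_one (k : Fin 3) : k + 2 + 1 = k := by omega
lemma fin3_add_two_add_two (k : Fin 3) : k + 2 + 2 = k + 1 := by omega

lemma inner_eq_side_mul_side_mul_cosAt (V : Fin 3 → E) (k : Fin 3) :
    ⟪V (k + 1) - V k, V (k + 2) - V k⟫ = side V (k + 1) * side V (k + 2) * cosAt V k := by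
  simp only [side, cosAt, EuclideanGeometry.angle, vsub_eq_sub, fin3_add_one_add_one,
    fin3_add_one_add_two, fin3_add_two_add_one, fin3_add_two_add_two, dist_eq_norm]
  rw [← InnerProductGeometry.cos_angle_mul_norm_mul_norm, norm_sub_rev (V k)]
  ring

lemma orthicLength_eq (V : Fin 3 → E) (k : Fin 3) :
    orthicLength V = side V k * cosAt V k + side V (k + 1) * cosAt V (k + 1) +
      side V (k + 2) * cosAt V (k + 2) := by
  rw [orthicLength, Fin.sum_univ_three]
  fin_cases k <;> simp <;> ring

lemma side_eq_proj {V : Fin 3 → E} (hV : IsAcute V) (k : Fin 3) :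
    side V k = side V (k + 1) * cosAt V (k + 2) + side V (k + 2) * cosAt V (k + 1) := by
  have h1 := inner_eq_side_mul_side_mul_cosAt V (k + 1)
  have h2 := inner_eq_side_mul_side_mul_cosAt V (k + 2)
  have ha : side V k ^ 2 = ⟪V (k + 2) - V (k + 1), V (k + 2) - V (k + 1)⟫ := by
    rw [side, dist_comm, dist_eq_norm, real_inner_self_eq_norm_sq]
  simp only [fin3_add_one_add_one, fin3_add_one_add_two, fin3_add_two_add_one,
    fin3_add_two_add_two] at h1 h2
  have hpos := hV.side_pos k
  apply mul_left_cancel₀ hpos.ne'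
  have : ⟪V (k + 2) - V (k + 1), V (k + 2) - V (k + 1)⟫ =
      ⟪V (k + 2) - V (k + 1), V k - V (k + 1)⟫ + ⟪V k - V (k + 2), V (k + 1) - V (k + 2)⟫ := by
    rw [← neg_sub (V (k + 2)) (V (k + 1)), inner_neg_right, real_inner_comm, ← sub_eq_add_neg,
      real_inner_comm _ (V k - V (k + 2)), ← inner_sub_right]
    congr 1; abel
  linarith

/-- With p and q the vectors from `V (k + 2)` to `V k` and `V (k + 1)`, the scaling exchanges the
lengths of p and q and keeps their inner product. Hence the scaled difference is as long as p - q,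
which is the side k + 2. -/
lemma norm_flow {V : Fin 3 → E} (hV : IsAcute V) (k : Fin 3) : ‖flow V k‖ = 1 := by
  have ha := hV.side_pos k
  have hb := hV.side_pos (k + 1)
  have hc := hV.side_pos (k + 2)
  have ea : ‖V (k + 1) - V (k + 2)‖ = side V k := by rw [side, dist_eq_norm]
  have eb : ‖V k - V (k + 2)‖ = side V (k + 1) := by
    rw [side, dist_comm, dist_eq_norm, fin3_add_one_add_two, fin3_add_one_add_one]
  have ec : ‖(V k - V (k + 2)) - (V (k + 1) - V (k + 2))‖ = side V (k + 2) := by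
    rw [side, dist_eq_norm, fin3_add_two_add_one, fin3_add_two_add_two, sub_sub_sub_cancel_right]
  rw [flow, norm_smul, norm_inv, Real.norm_of_nonneg hc.le, inv_mul_eq_one₀ hc.ne',
    ← sq_eq_sq₀ hc.le (norm_nonneg _)]
  nth_rw 1 [← ec]
  generalize V k - V (k + 2) = p at *
  generalize V (k + 1) - V (k + 2) = q at *
  rw [norm_sub_sq_real, norm_sub_sq_real, norm_smul, norm_smul, inner_smul_left, inner_smul_right,
    ea, eb, Real.norm_of_nonneg (by positivity), Real.norm_of_nonneg (by positivity)]
  simp only [conj_trivial]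
  field_simp
  ring

lemma inner_flow_edge {V : Fin 3 → E} (hV : IsAcute V) (k : Fin 3) :
    ⟪flow V k, V (k + 2) - V (k + 1)⟫ = side V k * cosAt V k := by
  have ha := hV.side_pos k
  have hb := hV.side_pos (k + 1)
  have hc := hV.side_pos (k + 2)
  have ea : ⟪V (k + 1) - V (k + 2), V (k + 1) - V (k + 2)⟫ = side V k ^ 2 := by
    rw [side, dist_eq_norm, real_inner_self_eq_norm_sq]
  have eb : ⟪V k - V (k + 2), V k - V (k + 2)⟫ = side V (k + 1) ^ 2 := by
    rw [side, dist_comm, dist_eq_norm, fin3_add_one_add_two, fin3_add_one_add_one,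
      real_inner_self_eq_norm_sq]
  have h0 := inner_eq_side_mul_side_mul_cosAt V k
  have : ⟪V (k + 1) - V k, V (k + 2) - V k⟫ =
      ⟪V k - V (k + 2), V k - V (k + 2)⟫ - ⟪V k - V (k + 2), V (k + 1) - V (k + 2)⟫ := by
    rw [← inner_sub_right, ← neg_sub (V k) (V (k + 2)), inner_neg_right, real_inner_comm,
      ← inner_neg_right]
    congr 1; abel
  rw [flow, inner_smul_left, inner_sub_left, inner_smul_left, inner_smul_left,
    ← neg_sub (V (k + 1)) (V (k + 2)), inner_neg_right, inner_neg_right, ea]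
  rw [h0, eb] at this
  have e : ⟪V k - V (k + 2), V (k + 1) - V (k + 2)⟫ =
    side V (k + 1) ^ 2 - side V (k + 1) * side V (k + 2) * cosAt V k := by linarith
  rw [e]
  simp only [conj_trivial]
  field_simp
  ring

/-- Together with `inner_flow_edge` at k + 1 this is the law of reflection at the edge k + 1. -/
lemma inner_flow_next_edge {V : Fin 3 → E} (hV : IsAcute V) (k : Fin 3) :
    ⟪flow V k, V k - V (k + 2)⟫ = side V (k + 1) * cosAt V (k + 1) := by
  have ha := hV.side_pos k
  have hb := hV.side_pos (k + 1)
  have hc := hV.side_pos (k + 2)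
  have ea : ⟪V (k + 1) - V (k + 2), V (k + 1) - V (k + 2)⟫ = side V k ^ 2 := by
    rw [side, dist_eq_norm, real_inner_self_eq_norm_sq]
  have eb : ⟪V k - V (k + 2), V k - V (k + 2)⟫ = side V (k + 1) ^ 2 := by
    rw [side, dist_comm, dist_eq_norm, fin3_add_one_add_two, fin3_add_one_add_one,
      real_inner_self_eq_norm_sq]
  have h0 := inner_eq_side_mul_side_mul_cosAt V (k + 1)
  simp only [fin3_add_one_add_one, fin3_add_one_add_two] at h0
  have : ⟪V (k + 2) - V (k + 1), V k - V (k + 1)⟫ =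
      ⟪V (k + 1) - V (k + 2), V (k + 1) - V (k + 2)⟫ -
        ⟪V k - V (k + 2), V (k + 1) - V (k + 2)⟫ := by
    rw [← inner_sub_left, ← neg_sub (V (k + 1)) (V (k + 2)), inner_neg_left, real_inner_comm,
      ← inner_neg_left]
    congr 1; abel
  rw [flow, inner_smul_left, inner_sub_left, inner_smul_left, inner_smul_left, eb]
  rw [h0, ea] at this
  have e : ⟪V k - V (k + 2), V (k + 1) - V (k + 2)⟫ =
    side V k ^ 2 - side V (k + 2) * side V k * cosAt V (k + 1) := by linarith
  rw [real_inner_comm, e]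
  simp only [conj_trivial]
  field_simp
  ring

/-- The sum of the unit vectors along the oriented sides has squared norm 3 - 2(cos A + cos B + cos
C) ≥ 0. This gives 3/2; the bound 2 is all that the potential argument needs. -/
lemma sum_cosAt_le {V : Fin 3 → E} (hV : IsAcute V) (k : Fin 3) :
    cosAt V k + cosAt V (k + 1) + cosAt V (k + 2) ≤ 2 := by
  have key : ∀ (p q r : E) (a b c x y z : ℝ), 0 < a → 0 < b → 0 < c →
      ‖p‖ = a → ‖q‖ = b → ‖r‖ = c → ⟪q, r⟫ = - (b * c * x) → ⟪r, p⟫ = - (c * a * y) →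
      ⟪p, q⟫ = - (a * b * z) → x + y + z ≤ 2 := by
    intro p q r a b c x y z ha hb hc hp hq hr h1 h2 h3
    have h := real_inner_self_nonneg (x := a⁻¹ • p + b⁻¹ • q + c⁻¹ • r)
    simp only [inner_add_left, inner_add_right, inner_smul_left, inner_smul_right,
      conj_trivial, real_inner_self_eq_norm_sq, hp, hq, hr, h1, h2, h3,
      real_inner_comm r p, real_inner_comm q r, real_inner_comm p q] at h
    field_simp at h
    linarith
  have h0 := inner_eq_side_mul_side_mul_cosAt V k
  have h1 := inner_eq_side_mul_side_mul_cosAt V (k + 1)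
  have h2 := inner_eq_side_mul_side_mul_cosAt V (k + 2)
  simp only [fin3_add_one_add_one, fin3_add_one_add_two, fin3_add_two_add_one,
    fin3_add_two_add_two] at h0 h1 h2
  refine key (V (k + 2) - V (k + 1)) (V k - V (k + 2)) (V (k + 1) - V k)
    (side V k) (side V (k + 1)) (side V (k + 2)) _ _ _ (hV.side_pos _) (hV.side_pos _)
    (hV.side_pos _) ?_ ?_ ?_ ?_ ?_ ?_
  · rw [side, dist_comm, dist_eq_norm]
  · rw [side, dist_comm, dist_eq_norm, fin3_add_one_add_two, fin3_add_one_add_one]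
  · rw [side, dist_comm, dist_eq_norm, fin3_add_two_add_one, fin3_add_two_add_two]
  · rw [← h0, real_inner_comm, ← inner_neg_right, neg_sub]
  · rw [← h1, real_inner_comm, ← inner_neg_right, neg_sub]
  · rw [← h2, real_inner_comm, ← inner_neg_right, neg_sub]

end Geometry

end Patrolling

/-! ### Phases, and lower bounds for paths between edges. -/

namespace Patrolling

section Geometry

variable {E : Type*} [NormedAddCommGroup E] [InnerProductSpace ℝ E]

/-- The edge opposite to the vertex `k`. -/
def oppEdge (V : Fin 3 → E) (k : Fin 3) : Set E :=
  segment ℝ (V (k + 1)) (V (k + 2))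

/-- The component along the outgoing orthic direction of the position on the edge `k`. -/
noncomputable def phase (V : Fin 3 → E) (k : Fin 3) (x : E) : ℝ :=
  ⟪flow V k, x - V (k + 1)⟫

lemma exists_of_mem_oppEdge {V : Fin 3 → E} {k : Fin 3} {x : E} (hx : x ∈ oppEdge V k) :
    ∃ t : ℝ, 0 ≤ t ∧ t ≤ 1 ∧ x - V (k + 1) = t • (V (k + 2) - V (k + 1)) := by
  rw [oppEdge, segment_eq_image'] at hx
  obtain ⟨t, ht, rfl⟩ := hx
  exact ⟨t, ht.1, ht.2, add_sub_cancel_left _ _⟩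

/-- By reflection, the incoming and the outgoing direction measure the position on an edge alike, so
one phase per edge suffices. -/
lemma inner_flow_of_mem_next {V : Fin 3 → E} (hV : IsAcute V) {k : Fin 3} {x : E}
    (hx : x ∈ oppEdge V (k + 1)) : ⟪flow V k, x - V (k + 2)⟫ = phase V (k + 1) x := by
  obtain ⟨t, -, -, ht⟩ := exists_of_mem_oppEdge hx
  rw [phase, ht, inner_smul_right, inner_flow_edge hV]
  rw [fin3_add_one_add_one, fin3_add_one_add_two] at ht
  rw [ht, inner_smul_right, inner_flow_next_edge hV]

lemma phase_sub_phase_add_le_dist {V : Fin 3 → E} (hV : IsAcute V) {k : Fin 3} (x : E) {y : E}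
    (hy : y ∈ oppEdge V (k + 1)) :
    phase V (k + 1) y - phase V k x + side V k * cosAt V k ≤ dist x y := by
  have h := real_inner_le_norm (flow V k) (y - x)
  rw [norm_flow hV, one_mul, ← dist_eq_norm, dist_comm] at h
  rw [← inner_flow_of_mem_next hV hy, ← inner_flow_edge hV, phase]
  refine le_trans (le_of_eq ?_) h
  rw [← inner_sub_right, ← inner_add_right]
  congr 1; abel

lemma phase_nonneg {V : Fin 3 → E} (hV : IsAcute V) {k : Fin 3} {x : E}
    (hx : x ∈ oppEdge V k) : 0 ≤ phase V k x := by
  obtain ⟨t, h0, h1, ht⟩ := exists_of_mem_oppEdge hx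
  rw [phase, ht, inner_smul_right, inner_flow_edge hV]
  have := (hV.side_pos k).le
  have := (hV.cosAt_pos k).le
  positivity

/-- The flow makes with the edge k an angle whose cosine is `cosAt V k`, so moving along the edge
gains phase at no more than this rate. -/
lemma phase_sub_phase_le {V : Fin 3 → E} (hV : IsAcute V) {k : Fin 3} {x y : E}
    (hx : x ∈ oppEdge V k) (hy : y ∈ oppEdge V k) :
    phase V k y - phase V k x ≤ cosAt V k * dist x y := by
  obtain ⟨t, -, -, ht⟩ := exists_of_mem_oppEdge hx
  obtain ⟨r, -, -, hr⟩ := exists_of_mem_oppEdge hy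
  have hd : dist x y = |r - t| * side V k := by
    rw [dist_comm, dist_eq_norm, ← sub_sub_sub_cancel_right y x (V (k + 1)), ht, hr, ← sub_smul,
      norm_smul, side, dist_comm, dist_eq_norm, Real.norm_eq_abs]
  rw [phase, phase, ht, hr, inner_smul_right, inner_smul_right, inner_flow_edge hV, hd]
  have := mul_le_mul_of_nonneg_right (le_abs_self (r - t))
    (mul_nonneg (hV.side_pos k).le (hV.cosAt_pos k).le)
  linarith

/-- A vector orthogonal to the edge `k`, of norm at most two, that measures the vertex `k` as
the orthic perimeter. -/
lemma inner_flow_sub_flow_vertex {V : Fin 3 → E} (hV : IsAcute V) (k : Fin 3) :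
    ⟪flow V (k + 2) - flow V k, V (k + 1) - V k⟫ = orthicLength V := by
  have h1 := inner_flow_edge hV (k + 2)
  have h2 := inner_flow_edge hV k
  have h3 := inner_flow_next_edge hV k
  rw [fin3_add_two_add_two, fin3_add_two_add_one] at h1
  have : V (k + 1) - V k = -(V (k + 2) - V (k + 1)) - (V k - V (k + 2)) := by abel
  rw [inner_sub_left, h1, this, inner_sub_right, inner_neg_right, h2, h3, orthicLength_eq V k]
  ring

lemma inner_flow_sub_flow_edge {V : Fin 3 → E} (hV : IsAcute V) (k : Fin 3) :
    ⟪flow V (k + 2) - flow V k, V (k + 2) - V (k + 1)⟫ = 0 := by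
  have h1 := inner_flow_next_edge hV (k + 2)
  rw [fin3_add_two_add_two, fin3_add_two_add_one] at h1
  rw [inner_sub_left, h1, inner_flow_edge hV, sub_self]

lemma inner_flow_sub_flow_le {V : Fin 3 → E} (hV : IsAcute V) (k : Fin 3) (x y : E) :
    ⟪flow V (k + 2) - flow V k, x - y⟫ ≤ 2 * dist y x := by
  have h1 := real_inner_le_norm (flow V (k + 2)) (x - y)
  have h2 := real_inner_le_norm (flow V k) (-(x - y))
  rw [norm_neg, norm_flow hV, one_mul, inner_neg_right] at h2
  rw [norm_flow hV, one_mul] at h1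
  rw [inner_sub_left, dist_comm, dist_eq_norm]
  linarith

/-- A point of one edge has distance sum at least half of the orthic perimeter from points of the
two other edges. -/
lemma orthicLength_le_two_mul_dist_add_dist {V : Fin 3 → E} (hV : IsAcute V) {k : Fin 3}
    {x y z : E} (hy : y ∈ oppEdge V k) (hx : x ∈ oppEdge V (k + 1))
    (hz : z ∈ oppEdge V (k + 2)) : orthicLength V ≤ 2 * (dist y x + dist y z) := by
  obtain ⟨t, -, -, ht⟩ := exists_of_mem_oppEdge hy
  obtain ⟨a, -, -, ha⟩ := exists_of_mem_oppEdge hx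
  obtain ⟨b, -, -, hb⟩ := exists_of_mem_oppEdge hz
  have h1 := inner_flow_sub_flow_le hV (k + 1) x y
  have h2 := inner_flow_sub_flow_le hV (k + 2) z y
  have e1 := inner_flow_sub_flow_vertex hV (k + 1)
  have e2 := inner_flow_sub_flow_vertex hV (k + 2)
  have f1 := inner_flow_sub_flow_edge hV (k + 1)
  have f2 := inner_flow_sub_flow_edge hV (k + 2)
  simp only [fin3_add_one_add_one, fin3_add_one_add_two, fin3_add_two_add_one,
    fin3_add_two_add_two] at ha hb h1 h2 e1 e2 f1 f2
  -- If y divides the edge k in the ratio t : 1 - t, the differences of flows kill the components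
  -- along the other two edges. What remains is (1 - t)P ≤ 2|yx| and tP ≤ 2|yz|, to be added.
  have hxy : x - y = a • (V k - V (k + 2)) + (1 - t) • (V (k + 2) - V (k + 1)) := by
    rw [sub_smul, one_smul, ← ha, ← ht]; abel
  have hzy : z - y = b • (V (k + 1) - V k) + ((V k - V (k + 2)) +
      (1 - t) • (V (k + 2) - V (k + 1))) := by
    rw [sub_smul, one_smul, ← hb, ← ht]; abel
  have e3 : ⟪flow V (k + 1) - flow V (k + 2), V (k + 2) - V (k + 1)⟫ = -orthicLength V := by
    have : V (k + 2) - V (k + 1) = -(V (k + 1) - V k) - (V k - V (k + 2)) := by abel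
    rw [this, inner_sub_right, inner_neg_right, f2, e2]
    ring
  rw [hxy, inner_add_right, inner_smul_right, inner_smul_right, f1, e1] at h1
  rw [hzy, inner_add_right, inner_add_right, inner_smul_right, inner_smul_right, f2, e2, e3] at h2
  linarith

lemma orthicLength_pos {V : Fin 3 → E} (hV : IsAcute V) : 0 < orthicLength V :=
  Finset.sum_pos (fun k _ => mul_pos (hV.side_pos k) (hV.cosAt_pos k)) Finset.univ_nonempty

lemma orthicLength_le_of_ne {V : Fin 3 → E} (hV : IsAcute V) {i j k : Fin 3} {x y z : E}
    (hij : i ≠ j) (hjk : j ≠ k) (hik : i ≠ k) (hx : x ∈ oppEdge V i) (hy : y ∈ oppEdge V j)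
    (hz : z ∈ oppEdge V k) : orthicLength V ≤ 2 * (dist x y + dist y z) := by
  have h : (i = j + 1 ∧ k = j + 2) ∨ (i = j + 2 ∧ k = j + 1) := by omega
  rw [dist_comm x y]
  obtain ⟨rfl, rfl⟩ | ⟨rfl, rfl⟩ := h
  · exact orthicLength_le_two_mul_dist_add_dist hV hy hx hz
  · rw [add_comm (dist y x)]
    exact orthicLength_le_two_mul_dist_add_dist hV hy hz hx

/-- A path that runs along the edges in cyclic order, possibly moving along each edge before it
leaves, cannot return to each edge in less time than the orthic perimeter. -/
lemma orthicLength_le_of_cyclic {V : Fin 3 → E} (hV : IsAcute V) {x y : ℕ → E} {G : ℝ}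
    (hx : ∀ j : ℕ, x j ∈ oppEdge V (Fin.ofNat 3 j)) (hy : ∀ j : ℕ, y j ∈ oppEdge V (Fin.ofNat 3 j))
    (hG : ∀ j, dist (y j) (x (j + 1)) + dist (x (j + 1)) (y (j + 1)) +
      dist (y (j + 1)) (x (j + 2)) + dist (x (j + 2)) (y (j + 2)) +
      dist (y (j + 2)) (x (j + 3)) ≤ G) : orthicLength V ≤ G := by
  by_contra! hlt
  set κ : ℕ → Fin 3 := fun j => Fin.ofNat 3 j with hκ
  have κ1 : ∀ j, κ (j + 1) = κ j + 1 := fun j => by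
    ext; simp [hκ, Fin.ofNat, Fin.val_add]
  set w : ℕ → ℝ := fun j => 1 - cosAt V (κ j) with hw
  have w_pos : ∀ j, 0 < w j := fun j => sub_pos.2 (hV.cosAt_lt_one _)
  -- In the j-th run, `X j` and `A j` are the phases on entering and on leaving, and `d j` is the
  -- distance between these two points.
  set X : ℕ → ℝ := fun j => phase V (κ j) (x j) with hX
  set A : ℕ → ℝ := fun j => phase V (κ j) (y j) with hA
  set d : ℕ → ℝ := fun j => dist (x j) (y j) with hd
  have X_nonneg : ∀ j, 0 ≤ X j := fun j => phase_nonneg hV (hx j)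
  have d_nonneg : ∀ j, 0 ≤ d j := fun j => dist_nonneg
  have κ2 : ∀ j, κ (j + 2) = κ j + 2 := fun j => by
    rw [κ1, κ1, fin3_add_one_add_one]
  have κ3 : ∀ j, κ (j + 3) = κ j := fun j => by
    rw [κ1, κ2, fin3_add_two_add_one]
  have w3 : ∀ j, w (j + 3) = w j := fun j => by simp only [hw, κ3]
  have stroll : ∀ j, A j - X j ≤ (1 - w j) * d j := fun j => by
    have := phase_sub_phase_le hV (hx j) (hy j)
    simpa only [hw, sub_sub_cancel] using this
  have leave : ∀ j, X (j + 1) - A j + side V (κ j) * cosAt V (κ j) ≤ dist (y j) (x (j + 1)) :=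
    fun j => by
      have h := hx (j + 1)
      change x (j + 1) ∈ oppEdge V (κ (j + 1)) at h
      rw [κ1] at h
      have := phase_sub_phase_add_le_dist hV (y j) h
      simpa only [hX, hA, κ1] using this
  have w_sum : ∀ j, 1 - w j ≤ w (j + 1) + w (j + 2) := fun j => by
    have := sum_cosAt_le hV (κ j)
    simp only [hw, κ1]
    simp only [fin3_add_one_add_one]
    linarith
  -- The window from `y j` to `x (j + 3)` contains the movements j + 1 and j + 2 but not j. The
  -- latter enters only through `A j`, with coefficient 1 - w j, which `w_sum` replaces by w (j + 1)
  -- + w (j + 2).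
  have gap_le : ∀ j, orthicLength V - G ≤
      X j - X (j + 3) + (w (j + 1) + w (j + 2)) * d j - w (j + 1) * d (j + 1) -
        w (j + 2) * d (j + 2) := fun j => by
    have h0 := leave j
    have h1 := leave (j + 1)
    have h2 := leave (j + 2)
    have s0 := stroll j
    have s1 := stroll (j + 1)
    have s2 := stroll (j + 2)
    have hP := orthicLength_eq V (κ j)
    have hGj := hG j
    rw [← κ1, ← κ2] at hP
    have := mul_le_mul_of_nonneg_right (w_sum j) (d_nonneg j)
    change dist (y j) (x (j + 1)) + d (j + 1) + dist (y (j + 1)) (x (j + 2)) + d (j + 2) +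
      dist (y (j + 2)) (x (j + 3)) ≤ G at hGj
    simp only [add_assoc, Nat.reduceAdd] at *
    linarith
  -- Chosen so that w j times the right side of `gap_le` is exactly Ψ j - Ψ (j + 1), by the
  -- 3-periodicity of w. Being nonnegative, Ψ cannot decrease forever by a fixed amount.
  set Ψ : ℕ → ℝ := fun j => w j * X j + w (j + 1) * X (j + 1) + w (j + 2) * X (j + 2) +
    w (j + 2) * (w j * d j) + w (j + 1) * (w j * d j) + w (j + 2) * (w (j + 1) * d (j + 1)) with hΨ
  have Ψ_nonneg : ∀ j, 0 ≤ Ψ j := fun j => by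
    have := fun j => (w_pos j).le
    have h1 := fun i => mul_nonneg (this i) (X_nonneg i)
    have h2 := fun i l => mul_nonneg (this i) (mul_nonneg (this l) (d_nonneg l))
    simp only [hΨ]
    linarith [h1 j, h1 (j + 1), h1 (j + 2), h2 (j + 2) j, h2 (j + 1) j, h2 (j + 2) (j + 1)]
  have Ψ_step : ∀ j, w j * (orthicLength V - G) ≤ Ψ j - Ψ (j + 1) := fun j => by
    refine (mul_le_mul_of_nonneg_left (gap_le j) (w_pos j).le).trans (le_of_eq ?_)
    simp only [hΨ, add_assoc, Nat.reduceAdd]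
    rw [w3]
    ring
  obtain ⟨ε, hε, hεw⟩ : ∃ ε > 0, ∀ j, ε ≤ w j := by
    obtain ⟨k, -, hk⟩ := Finset.exists_max_image Finset.univ (cosAt V) Finset.univ_nonempty
    exact ⟨1 - cosAt V k, sub_pos.2 (hV.cosAt_lt_one k),
      fun j => sub_le_sub_left (hk _ (Finset.mem_univ _)) _⟩
  have hgap := sub_pos.2 hlt
  have bound : ∀ n : ℕ, n * (ε * (orthicLength V - G)) ≤ Ψ 0 - Ψ n := by
    intro n
    induction n with
    | zero => simp
    | succ n ih =>
      have := mul_le_mul_of_nonneg_right (hεw n) hgap.le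
      have := Ψ_step n
      push_cast
      linarith
  obtain ⟨n, hn⟩ := exists_nat_gt (Ψ 0 / (ε * (orthicLength V - G)))
  rw [div_lt_iff₀ (mul_pos hε hgap)] at hn
  linarith [bound n, Ψ_nonneg n]

end Geometry

end Patrolling

/-! ### Reduction of arbitrary feasible sequences to the cyclic case. -/

namespace Patrolling

section Geometry

variable {E : Type*} [NormedAddCommGroup E] [InnerProductSpace ℝ E]

section Relabel

/-- A permutation of three indices keeps or reverses the cyclic order; the symmetry of sides, angles
and segments covers the reversal. -/
lemma fin3_injective_cases {π : Fin 3 → Fin 3} (hπ : π.Injective) (k : Fin 3) :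
    (π (k + 1) = π k + 1 ∧ π (k + 2) = π k + 2) ∨
      (π (k + 1) = π k + 2 ∧ π (k + 2) = π k + 1) := by
  have h1 : π (k + 1) ≠ π k := hπ.ne (by omega)
  have h2 : π (k + 2) ≠ π k := hπ.ne (by omega)
  have h3 : π (k + 1) ≠ π (k + 2) := hπ.ne (by omega)
  omega

omit [InnerProductSpace ℝ E] in
lemma side_comp (V : Fin 3 → E) {π : Fin 3 → Fin 3} (hπ : π.Injective) (k : Fin 3) :
    side (V ∘ π) k = side V (π k) := by
  rcases fin3_injective_cases hπ k with ⟨h1, h2⟩ | ⟨h1, h2⟩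
  · simp [side, h1, h2]
  · simp [side, h1, h2, dist_comm]

lemma cosAt_comp (V : Fin 3 → E) {π : Fin 3 → Fin 3} (hπ : π.Injective) (k : Fin 3) :
    cosAt (V ∘ π) k = cosAt V (π k) := by
  rcases fin3_injective_cases hπ k with ⟨h1, h2⟩ | ⟨h1, h2⟩
  · simp [cosAt, h1, h2]
  · simp [cosAt, h1, h2, EuclideanGeometry.angle_comm]

lemma oppEdge_comp (V : Fin 3 → E) {π : Fin 3 → Fin 3} (hπ : π.Injective) (k : Fin 3) :
    oppEdge (V ∘ π) k = oppEdge V (π k) := by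
  rcases fin3_injective_cases hπ k with ⟨h1, h2⟩ | ⟨h1, h2⟩
  · simp [oppEdge, h1, h2]
  · simp [oppEdge, h1, h2, segment_symm]

lemma IsAcute.comp {V : Fin 3 → E} (hV : IsAcute V) {π : Fin 3 → Fin 3} (hπ : π.Injective) :
    IsAcute (V ∘ π) where
  side_pos k := by rw [side_comp V hπ]; exact hV.side_pos _
  cosAt_pos k := by rw [cosAt_comp V hπ]; exact hV.cosAt_pos _
  cosAt_lt_one k := by rw [cosAt_comp V hπ]; exact hV.cosAt_lt_one _

lemma orthicLength_comp (V : Fin 3 → E) {π : Fin 3 → Fin 3} (hπ : π.Injective) :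
    orthicLength (V ∘ π) = orthicLength V := by
  simp only [orthicLength, side_comp V hπ, cosAt_comp V hπ]
  exact (Finite.injective_iff_bijective.1 hπ).sum_comp (fun k => side V k * cosAt V k)

end Relabel

section Walk

lemma fin3_eq_of_step {a b c τ : Fin 3} (hτ : τ ≠ 0) (h : b = a + τ) (h1 : c ≠ b) (h2 : c ≠ b + τ) :
    a = c := by
  subst h
  revert a c τ
  decide

/-- If a sequence with values in `Fin 3` never returns to a value from a different one without
visiting the third, then from its first change on it runs through the values cyclically. -/
lemma exists_direction {e : ℕ → Fin 3} {N : ℕ} (hinf : ∀ k n, ∃ l, n ≤ l ∧ e l = k)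
    (hret : ∀ p q r, N ≤ p → p ≤ q → q ≤ r → e p = e r → e p ≠ e q →
      ∀ k, k ≠ e p → k ≠ e q → ∃ m, p ≤ m ∧ m ≤ r ∧ e m = k) :
    ∃ M, N ≤ M ∧ ∃ σ : Fin 3, σ ≠ 0 ∧ ∀ i, M ≤ i → e (i + 1) = e i ∨ e (i + 1) = e i + σ := by
  obtain ⟨i₀, hi₀, hne⟩ : ∃ i, N ≤ i ∧ e (i + 1) ≠ e i := by
    by_contra! h
    have hc : ∀ i, N ≤ i → e i = e N := fun i hi => by
      induction i, hi using Nat.le_induction with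
      | base => rfl
      | succ i hi ih => rw [h i hi, ih]
    obtain ⟨l, hl, hel⟩ := hinf (e N + 1) N
    rw [hc l hl] at hel
    omega
  set σ := e (i₀ + 1) - e i₀ with hσ
  have hσ0 : σ ≠ 0 := sub_ne_zero.2 hne
  -- The run ending at i was entered from e i - σ at step p. Any other move would return to that
  -- value, with the third value not met in between.
  have step : ∀ i p, N ≤ p → p < i → e i = e p + σ → (∀ m, p < m → m ≤ i → e m = e i) →
      e (i + 1) = e i ∨ e (i + 1) = e i + σ := by
    intro i p hNp hpi hep hconst
    by_contra! hcon
    have hback : e p = e (i + 1) := fin3_eq_of_step hσ0 hep hcon.1 hcon.2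
    obtain ⟨m, hpm, hmi, hm⟩ := hret p i (i + 1) hNp hpi.le (Nat.le_succ i) hback
      (by omega) (e i + σ) (by omega) (by omega)
    rcases hpm.eq_or_lt with rfl | hpm
    · omega
    · rcases Nat.le_succ_iff.1 hmi with hmi | rfl
      · have := hconst m hpm hmi
        omega
      · exact hcon.2 hm
  have inv : ∀ i, i₀ + 1 ≤ i → ∃ p, N ≤ p ∧ p < i ∧ e i = e p + σ ∧
      ∀ m, p < m → m ≤ i → e m = e i := by
    intro i hi
    induction i, hi using Nat.le_induction with
    | base =>
      refine ⟨i₀, hi₀, Nat.lt_succ_self _, by omega, fun m h1 h2 => ?_⟩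
      rw [le_antisymm h2 h1]
    | succ i hi ih =>
      obtain ⟨p, hp, hpi, hep, hconst⟩ := ih
      rcases step i p hp hpi hep hconst with h | h
      · refine ⟨p, hp, by omega, by rw [h, hep], fun m h1 h2 => ?_⟩
        rcases Nat.le_succ_iff.1 h2 with h2 | rfl
        · rw [hconst m h1 h2, h]
        · rfl
      · refine ⟨i, by omega, Nat.lt_succ_self _, h, fun m h1 h2 => ?_⟩
        rw [le_antisymm h2 h1]
  refine ⟨i₀ + 1, by omega, σ, hσ0, fun i hi => ?_⟩
  obtain ⟨p, hp, hpi, hep, hconst⟩ := inv i hi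
  exact step i p hp hpi hep hconst

/-- A sequence that runs cyclically through the values decomposes into runs. -/
lemma exists_runs {e : ℕ → Fin 3} {M : ℕ} {σ : Fin 3}
    (hinf : ∀ k n, ∃ l, n ≤ l ∧ e l = k)
    (hstep : ∀ i, M ≤ i → e (i + 1) = e i ∨ e (i + 1) = e i + σ) :
    ∃ α β : ℕ → ℕ, (∀ j, M ≤ α j) ∧ (∀ j, α j ≤ β j) ∧ (∀ j, α (j + 1) = β j + 1) ∧
      ∀ j m, α j ≤ m → m ≤ β j → e m = e M + σ * Fin.ofNat 3 j := by
  have hnext : ∀ n, ∃ b, M ≤ n → n ≤ b ∧ (∀ m, n ≤ m → m ≤ b → e m = e n) ∧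
      e (b + 1) = e n + σ := by
    intro n
    by_cases hn : M ≤ n
    swap
    -- Nothing is required when n < M, so the witness is arbitrary.
    · exact ⟨0, fun h => absurd h hn⟩
    have hex : ∃ b, n ≤ b ∧ e (b + 1) ≠ e b := by
      by_contra! h
      have hc : ∀ i, n ≤ i → e i = e n := fun i hi => by
        induction i, hi using Nat.le_induction with
        | base => rfl
        | succ i hi ih => rw [h i hi, ih]
      obtain ⟨l, hl, hel⟩ := hinf (e n + 1) n
      rw [hc l hl] at hel
      omega
    classical
    obtain ⟨hb, hne⟩ := Nat.find_spec hex
    have hmin := fun m => Nat.find_min hex (m := m)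
    set b := Nat.find hex
    have hconst : ∀ m, n ≤ m → m ≤ b → e m = e n := by
      intro m hm
      induction m, hm using Nat.le_induction with
      | base => exact fun _ => rfl
      | succ m hm ih =>
        intro h
        have := hmin m h
        push Not at this
        rw [this hm, ih (by omega)]
    refine ⟨b, fun _ => ⟨hb, hconst, ?_⟩⟩
    rw [← hconst b hb le_rfl]
    exact (hstep b (hn.trans hb)).resolve_left hne
  choose nxt hnxt using hnext
  set α : ℕ → ℕ := fun j => (fun n => nxt n + 1)^[j] M with hα
  have α_succ : ∀ j, α (j + 1) = nxt (α j) + 1 := fun j => Function.iterate_succ_apply' _ _ _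
  have hM : ∀ j, M ≤ α j := by
    intro j
    induction j with
    | zero => exact le_rfl
    | succ j ih =>
      have := (hnxt _ ih).1
      rw [α_succ]
      omega
  have he : ∀ j, e (α j) = e M + σ * Fin.ofNat 3 j := by
    intro j
    induction j with
    | zero => simp [hα]
    | succ j ih =>
      rw [α_succ, (hnxt _ (hM j)).2.2, ih]
      have : Fin.ofNat 3 (j + 1) = Fin.ofNat 3 j + 1 := by ext; simp [Fin.ofNat, Fin.val_add]
      rw [this, mul_add, mul_one, add_assoc]
  exact ⟨α, fun j => nxt (α j), hM, fun j => (hnxt _ (hM j)).1, α_succ,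
    fun j m h1 h2 => ((hnxt _ (hM j)).2.1 m h1 h2).trans (he j)⟩

/-- Along any feasible sequence of points on the edges, no bound smaller than the orthic perimeter
holds for the lengths of the paths between consecutive visits. -/
theorem orthicLength_le_of_gap_le {V : Fin 3 → E} (hV : IsAcute V) {s : ℕ → E} {G : ℝ}
    (hs : ∀ i, ∃ k, s i ∈ oppEdge V k) (hinf : ∀ k n, ∃ l, n ≤ l ∧ s l ∈ oppEdge V k)
    (hG : ∀ k i j, i < j → s i ∈ oppEdge V k → s j ∈ oppEdge V k →
      (∀ m, i < m → m < j → s m ∉ oppEdge V k) →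
        ∑ m ∈ Finset.Ico i j, dist (s m) (s (m + 1)) ≤ G) :
    orthicLength V ≤ G := by
  classical
  by_contra! hlt
  set T : ℕ → ℕ → ℝ := fun i j => ∑ m ∈ Finset.Ico i j, dist (s m) (s (m + 1)) with hT
  have T_add : ∀ {i j l}, i ≤ j → j ≤ l → T i l = T i j + T j l := fun h1 h2 =>
    (Finset.sum_Ico_consecutive _ h1 h2).symm
  have le_T : ∀ {i j}, i ≤ j → dist (s i) (s j) ≤ T i j := fun h => dist_le_Ico_sum_dist s h
  choose first _ hfirst using fun k => hinf k 0
  -- From step N on, every edge has been visited, so a last earlier visit exists.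
  set N := Finset.univ.sup first with hN
  have first_le : ∀ k, first k ≤ N := fun k => Finset.le_sup (Finset.mem_univ k)
  have hreturn : ∀ p q r, N ≤ p → p ≤ q → q ≤ r → ∀ a b c : Fin 3, a ≠ b → c ≠ a → c ≠ b →
      s p ∈ oppEdge V a → s q ∈ oppEdge V b → s r ∈ oppEdge V a →
      ∃ m, p ≤ m ∧ m ≤ r ∧ s m ∈ oppEdge V c := by
    intro p q r hp hpq hqr a b c hab hca hcb hsp hsq hsr
    by_contra! hno
    have hbefore : ∃ i, i ≤ p ∧ s i ∈ oppEdge V c := ⟨first c, (first_le c).trans hp, hfirst c⟩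
    obtain ⟨i, hi, hsi, hlast⟩ : ∃ i, i ≤ p ∧ s i ∈ oppEdge V c ∧
        ∀ m, i < m → m ≤ p → s m ∉ oppEdge V c := by
      obtain ⟨i, hi, hsi⟩ := hbefore
      refine ⟨Nat.findGreatest (fun m => s m ∈ oppEdge V c) p, Nat.findGreatest_le _,
        Nat.findGreatest_spec (P := fun m => s m ∈ oppEdge V c) hi hsi,
        fun m h1 h2 => Nat.findGreatest_is_greatest h1 h2⟩
    obtain ⟨j, hj, hsj, hnext⟩ : ∃ j, r ≤ j ∧ s j ∈ oppEdge V c ∧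
        ∀ m, r ≤ m → m < j → s m ∉ oppEdge V c := by
      have hex := hinf c r
      refine ⟨Nat.find hex, (Nat.find_spec hex).1, (Nat.find_spec hex).2, fun m h1 h2 h3 => ?_⟩
      exact Nat.find_min hex h2 ⟨h1, h3⟩
    have hip : i < p := by
      refine lt_of_le_of_ne hi ?_
      rintro rfl
      exact hno i le_rfl (hpq.trans hqr) hsi
    have hgap := hG c i j (by omega) hsi hsj fun m h1 h2 h3 => by
      rcases le_or_gt m p with h | h
      · exact hlast m h1 h h3
      rcases le_or_gt m r with h' | h'
      · exact hno m h.le h' h3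
      · exact hnext m h'.le h2 h3
    change T i j ≤ G at hgap
    rw [T_add hi (by omega : p ≤ j), T_add hpq (by omega : q ≤ j), T_add hqr hj] at hgap
    -- The paths c, a, b and b, a, c each cost at least P/2, so this gap of c is at least P.
    have g1 := orthicLength_le_of_ne hV hca hab hcb hsi hsp hsq
    have g2 := orthicLength_le_of_ne hV hab.symm hca.symm hcb.symm hsq hsr hsj
    linarith [le_T hi, le_T hpq, le_T hqr, le_T hj]
  have hunique : ∀ p, N ≤ p → ∀ a b, s p ∈ oppEdge V a → s p ∈ oppEdge V b → a = b := by
    intro p hp a b ha hb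
    by_contra hab
    obtain ⟨c, hca, hcb⟩ : ∃ c : Fin 3, c ≠ a ∧ c ≠ b :=
      (by decide : ∀ a b : Fin 3, ∃ c, c ≠ a ∧ c ≠ b) a b
    -- A vertex counts as a return at a single step: it would have to lie on the third edge too,
    -- forcing P ≤ 0. Hence from step N on no vertex is visited and the edge of each point is
    -- determined.
    obtain ⟨m, h1, h2, hc⟩ := hreturn p p p hp le_rfl le_rfl a b c hab hca hcb ha hb ha
    obtain rfl := le_antisymm h1 h2
    have := orthicLength_le_of_ne hV hca hab hcb hc ha hb
    rw [dist_self, add_zero, mul_zero] at this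
    exact absurd (orthicLength_pos hV) this.not_gt
  choose e he using hs
  have he' : ∀ {p k}, N ≤ p → s p ∈ oppEdge V k → e p = k := fun hp hk =>
    hunique _ hp _ _ (he _) hk
  have einf : ∀ k n, ∃ l, n ≤ l ∧ e l = k := fun k n => by
    obtain ⟨l, hl, hk⟩ := hinf k (max n N)
    exact ⟨l, (le_max_left _ _).trans hl, he' ((le_max_right _ _).trans hl) hk⟩
  obtain ⟨M, hNM, σ, hσ, hstep⟩ := exists_direction (N := N) einf
    fun p q r hp hpq hqr hpr hne k hkp hkq => by
      obtain ⟨m, h1, h2, h3⟩ := hreturn p q r hp hpq hqr (e p) (e q) k hne hkp hkq (he p) (he q)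
        (hpr ▸ he r)
      exact ⟨m, h1, h2, he' (hp.trans h1) h3⟩
  obtain ⟨α, β, hMα, hαβ, hα, hrun⟩ := exists_runs einf hstep
  -- Relabelling by the starting edge and the direction σ puts the j-th run on the edge j mod 3.
  set π : Fin 3 → Fin 3 := fun k => e M + σ * k with hπ
  have π_inj : π.Injective := by
    have : ∀ τ : Fin 3, τ ≠ 0 → ∀ x y : Fin 3, τ * x = τ * y → x = y := by decide
    exact fun x y hxy => this σ hσ x y (add_left_cancel hxy)
  have hon : ∀ j m, α j ≤ m → m ≤ β j → s m ∈ oppEdge (V ∘ π) (Fin.ofNat 3 j) :=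
    fun j m h1 h2 => by
      rw [oppEdge_comp V π_inj]
      change s m ∈ oppEdge V (e M + σ * Fin.ofNat 3 j)
      rw [← hrun j m h1 h2]
      exact he m
  have hmain := orthicLength_le_of_cyclic (hV.comp π_inj) (x := fun j => s (α j))
    (y := fun j => s (β j)) (G := G) (fun j => hon j _ le_rfl (hαβ j))
    (fun j => hon j _ (hαβ j) le_rfl) fun j => by
      have h0 := hα j
      have h1 := hα (j + 1)
      have h2 := hα (j + 2)
      have l0 := hαβ j
      have l1 := hαβ (j + 1)
      have l2 := hαβ (j + 2)
      have l3 := hαβ (j + 3)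
      have m0 := hMα j
      simp only [add_assoc, Nat.reduceAdd] at h1 h2
      have hfin : ∀ i, Fin.ofNat 3 (i + 1) = Fin.ofNat 3 i + 1 := fun i => by
        ext; simp [Fin.ofNat, Fin.val_add]
      have hlast : s (α (j + 3)) ∈ oppEdge V (e (β j)) := by
        have := he (α (j + 3))
        rwa [hrun (j + 3) _ le_rfl l3, hfin, hfin, hfin, fin3_add_one_add_one,
          fin3_add_one_add_two, ← hrun j _ l0 le_rfl] at this
      -- The end of run j and the start of run j + 3 are consecutive visits of one edge, since runs
      -- j + 1 and j + 2 lie on the other two.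
      have hgap := hG (e (β j)) (β j) (α (j + 3)) (by omega) (he _) hlast fun m g1 g2 g3 => by
        have hm := he' (by omega : N ≤ m) g3
        have hne : ∀ i, Fin.ofNat 3 i ≠ Fin.ofNat 3 j → π (Fin.ofNat 3 i) ≠ e (β j) := by
          intro i hi
          rw [hrun j _ l0 le_rfl]
          exact π_inj.ne hi
        rcases le_or_gt m (β (j + 1)) with g | g
        · refine hne (j + 1) ?_ ((hrun (j + 1) m (by omega) g).symm.trans hm)
          rw [hfin]
          omega
        · refine hne (j + 2) ?_ ((hrun (j + 2) m (by omega) (by omega)).symm.trans hm)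
          rw [hfin, hfin]
          omega
      change T (β j) (α (j + 3)) ≤ G at hgap
      rw [T_add (by omega : β j ≤ α (j + 1)) (by omega),
        T_add (by omega : α (j + 1) ≤ β (j + 1)) (by omega),
        T_add (by omega : β (j + 1) ≤ α (j + 2)) (by omega),
        T_add (by omega : α (j + 2) ≤ β (j + 2)) (by omega)] at hgap
      linarith [le_T (by omega : β j ≤ α (j + 1)), le_T (by omega : α (j + 1) ≤ β (j + 1)),
        le_T (by omega : β (j + 1) ≤ α (j + 2)), le_T (by omega : α (j + 2) ≤ β (j + 2)),
        le_T (by omega : β (j + 2) ≤ α (j + 3))]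
  rw [orthicLength_comp V π_inj] at hmain
  exact absurd hmain hlt.not_ge

end Walk

end Geometry

end Patrolling

/-! ### Feet of the altitudes and the sides of the orthic triangle. -/

namespace Patrolling

section Feet

variable {E : Type*} [NormedAddCommGroup E] [InnerProductSpace ℝ E]

/-- The foot of the altitude from the vertex `k`, in barycentric coordinates. -/
noncomputable def foot (V : Fin 3 → E) (k : Fin 3) : E :=
  (side V (k + 1) * cosAt V (k + 2) / side V k) • V (k + 1) +
    (side V (k + 2) * cosAt V (k + 1) / side V k) • V (k + 2)

lemma foot_weights {V : Fin 3 → E} (hV : IsAcute V) (k : Fin 3) :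
    side V (k + 1) * cosAt V (k + 2) / side V k + side V (k + 2) * cosAt V (k + 1) / side V k =
      1 := by
  rw [← add_div, ← side_eq_proj hV, div_self (hV.side_pos k).ne']

lemma foot_mem_oppEdge {V : Fin 3 → E} (hV : IsAcute V) (k : Fin 3) : foot V k ∈ oppEdge V k := by
  have := fun k => (hV.side_pos k).le
  have := fun k => (hV.cosAt_pos k).le
  exact ⟨_, _, div_nonneg (mul_nonneg (by simp_all) (by simp_all)) (by simp_all),
    div_nonneg (mul_nonneg (by simp_all) (by simp_all)) (by simp_all), foot_weights hV k, rfl⟩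

lemma foot_sub_left {V : Fin 3 → E} (hV : IsAcute V) (k : Fin 3) :
    foot V k - V (k + 1) =
      (side V (k + 2) * cosAt V (k + 1) / side V k) • (V (k + 2) - V (k + 1)) := by
  rw [foot, eq_sub_of_add_eq (foot_weights hV k), sub_smul, one_smul, smul_sub]
  abel

lemma foot_sub_right {V : Fin 3 → E} (hV : IsAcute V) (k : Fin 3) :
    foot V k - V (k + 2) =
      (side V (k + 1) * cosAt V (k + 2) / side V k) • (V (k + 1) - V (k + 2)) := by
  rw [foot, eq_sub_of_add_eq' (foot_weights hV k), sub_smul, one_smul, smul_sub]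
  abel

/-- The vector between consecutive feet is a positive multiple of the unit vector `flow V k`, which
is why that vector is an orthic direction. -/
lemma dist_foot_foot {V : Fin 3 → E} (hV : IsAcute V) (k : Fin 3) :
    dist (foot V k) (foot V (k + 1)) = side V (k + 2) * cosAt V (k + 2) := by
  have hk := hV.side_pos k
  have hk1 := hV.side_pos (k + 1)
  have hk2 := hV.side_pos (k + 2)
  have h1 := foot_sub_left hV (k + 1)
  rw [fin3_add_one_add_one, fin3_add_one_add_two] at h1
  have h : foot V (k + 1) - foot V k = (side V (k + 2) * cosAt V (k + 2)) • flow V k := by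
    rw [← sub_sub_sub_cancel_right _ _ (V (k + 2)), h1, foot_sub_right hV, flow]
    simp only [smul_sub, smul_smul]
    congr 2 <;> congr 1 <;> field_simp
  rw [dist_comm, dist_eq_norm, h, norm_smul, norm_flow hV, mul_one,
    Real.norm_of_nonneg (mul_nonneg hk2.le (hV.cosAt_pos _).le)]

lemma inner_sub_foot {V : Fin 3 → E} (hV : IsAcute V) (k : Fin 3) :
    ⟪V (k + 2) - V (k + 1), V k - foot V k⟫ = 0 := by
  have h1 := inner_eq_side_mul_side_mul_cosAt V (k + 1)
  rw [fin3_add_one_add_one, fin3_add_one_add_two] at h1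
  have h2 : ⟪V (k + 2) - V (k + 1), V (k + 2) - V (k + 1)⟫ = side V k ^ 2 := by
    rw [side, dist_comm, dist_eq_norm, real_inner_self_eq_norm_sq]
  have hk := hV.side_pos k
  rw [← sub_sub_sub_cancel_right (V k) _ (V (k + 1)), foot_sub_left hV, inner_sub_right,
    inner_smul_right, h1, h2]
  field_simp
  ring

end Feet

/-! ### Acute affine triangles and their altitude feet. -/

section Triangle

lemma fin3_add_one_ne (k : Fin 3) : k + 1 ≠ k := by omega
lemma fin3_ne_add_two (k : Fin 3) : k ≠ k + 2 := by omega
lemma fin3_add_one_ne_add_two (k : Fin 3) : k + 1 ≠ k + 2 := by omega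
lemma fin3_ne_iff (i k : Fin 3) : ¬i = k ↔ i = k + 1 ∨ i = k + 2 := by omega

variable {E : Type*} [NormedAddCommGroup E] [InnerProductSpace ℝ E]

lemma isAcute_points {Δ : Affine.Triangle ℝ E} (hΔ : Δ.AcuteAngled) : IsAcute Δ.points where
  side_pos k := dist_pos.2 (Δ.independent.injective.ne (fin3_add_one_ne_add_two k))
  cosAt_pos k := by
    refine Real.cos_pos_of_mem_Ioo ⟨?_, hΔ _ _ _ (fin3_add_one_ne k) (fin3_add_one_ne_add_two k)
      (fin3_ne_add_two k)⟩
    linarith [Real.pi_pos, EuclideanGeometry.angle_nonneg (Δ.points (k + 1)) (Δ.points k)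
      (Δ.points (k + 2))]
  cosAt_lt_one k := by
    have hne : ∠ (Δ.points (k + 1)) (Δ.points k) (Δ.points (k + 2)) ≠ 0 := fun h =>
      (affineIndependent_iff_not_collinear_of_ne (k := ℝ) (p := Δ.points) (i₁ := k + 1) (i₂ := k)
        (i₃ := k + 2) (fin3_add_one_ne k) (fin3_add_one_ne_add_two k) (fin3_ne_add_two k)).1 Δ.independent
        (EuclideanGeometry.collinear_of_angle_eq_zero h)
    rw [cosAt, ← Real.cos_zero]
    exact Real.cos_lt_cos_of_nonneg_of_le_pi le_rfl (EuclideanGeometry.angle_le_pi _ _ _)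
      (lt_of_le_of_ne (EuclideanGeometry.angle_nonneg _ _ _) hne.symm)

lemma altitudeFoot_eq_foot {Δ : Affine.Triangle ℝ E} (hΔ : Δ.AcuteAngled) (k : Fin 3) :
    Δ.altitudeFoot k = foot Δ.points k := by
  have hV := isAcute_points hΔ
  have hrange : Set.range (Δ.faceOpposite k).points =
      {Δ.points (k + 1), Δ.points (k + 2)} := by
    rw [Affine.Simplex.range_faceOpposite_points, ← Set.image_pair]
    congr 1
    ext i
    simp only [Set.mem_compl_iff, Set.mem_singleton_iff, Set.mem_insert_iff]
    exact fin3_ne_iff i k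
  rw [Affine.Simplex.altitudeFoot, Affine.Simplex.orthogonalProjectionSpan,
    EuclideanGeometry.coe_orthogonalProjection_eq_iff_mem, hrange]
  constructor
  · have h := foot_sub_left hV k
    rw [sub_eq_iff_eq_add] at h
    rw [h]
    exact AffineMap.lineMap_mem_affineSpan_pair _ _ _
  · rw [direction_affineSpan, Submodule.mem_orthogonal]
    intro u hu
    obtain ⟨r, rfl⟩ := mem_vectorSpan_pair_rev.1 hu
    rw [vsub_eq_sub, vsub_eq_sub, inner_smul_left, inner_sub_foot hV, mul_zero]

end Triangle

/-! ### Gaps of schedules and the orthic schedule. -/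

section Schedules

variable {Δ : Affine.Triangle ℝ Plane} {s : ℕ → Plane}

lemma travelTime_eq_ofReal (s : ℕ → Plane) (i j : ℕ) :
    travelTime s i j = ENNReal.ofReal (∑ m ∈ Finset.Ico i j, dist (s m) (s (m + 1))) := by
  rw [travelTime, ENNReal.ofReal_sum_of_nonneg fun _ _ => dist_nonneg]
  simp only [edist_dist]

lemma IsFeasible.infinite_visits (hs : IsFeasible Δ s) (δ : Fin 3) :
    (Set.ofPred (Visits Δ s δ)).Infinite :=
  Set.infinite_of_forall_exists_gt fun n => by
    obtain ⟨l, hl, hv⟩ := hs.2 δ (n + 1)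
    exact ⟨l, hv, hl⟩

/-- The path between two consecutive visits of an edge is at most as long as the `1`-gap. -/
lemma travelTime_le_gap {δ : Fin 3} {i j : ℕ} (hij : i < j)
    (hi : Visits Δ s δ i) (hj : Visits Δ s δ j) (hno : ∀ m, i < m → m < j → ¬Visits Δ s δ m) :
    travelTime s i j ≤ gap Δ s 1 := by
  classical
  -- No visit lies strictly between i and j, so they are consecutive in the enumeration of visits by
  -- `Nat.nth`.
  have hcount : Nat.count (Visits Δ s δ) j = Nat.count (Visits Δ s δ) i + 1 := by
    have : ∀ l, i + 1 ≤ l → l ≤ j →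
        Nat.count (Visits Δ s δ) l = Nat.count (Visits Δ s δ) i + 1 := by
      intro l hl
      induction l, hl using Nat.le_induction with
      | base => intro _; rw [Nat.count_succ, if_pos hi]
      | succ l hl ih => intro h; rw [Nat.count_succ, if_neg (hno l hl h), ih (by omega), add_zero]
    exact this j hij le_rfl
  refine le_trans (le_of_eq ?_) (le_iSup_of_le δ (le_iSup_of_le (Nat.count (Visits Δ s δ) i) le_rfl))
  rw [gapSeq, ← hcount, Nat.nth_count hi, Nat.nth_count hj]

lemma gap_le_of_travelTime_le (hs : IsFeasible Δ s) {c : ℝ≥0∞}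
    (h : ∀ δ i j, i < j → Visits Δ s δ i → Visits Δ s δ j →
      (∀ m, i < m → m < j → ¬Visits Δ s δ m) → travelTime s i j ≤ c) : gap Δ s 1 ≤ c := by
  classical
  refine iSup_le fun δ => iSup_le fun k => ?_
  have hinf := hs.infinite_visits δ
  have hmono := Nat.nth_strictMono hinf
  refine h δ _ _ (hmono (Nat.lt_succ_self k)) (Nat.nth_mem_of_infinite hinf _)
    (Nat.nth_mem_of_infinite hinf _) fun m h1 h2 hm => ?_
  rw [← Nat.nth_count hm] at h1 h2
  have := hmono.lt_iff_lt.1 h1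
  have := hmono.lt_iff_lt.1 h2
  omega

theorem orthicLength_le_gap (hΔ : Δ.AcuteAngled) (hs : IsFeasible Δ s) :
    ENNReal.ofReal (orthicLength Δ.points) ≤ gap Δ s 1 := by
  by_cases htop : gap Δ s 1 = ⊤
  · rw [htop]; exact le_top
  rw [← ENNReal.ofReal_toReal htop]
  refine ENNReal.ofReal_le_ofReal (orthicLength_le_of_gap_le (isAcute_points hΔ) hs.1 hs.2
    fun k i j hij hi hj hno => ?_)
  have := travelTime_le_gap hij hi hj hno
  rwa [travelTime_eq_ofReal, ENNReal.ofReal_le_iff_le_toReal htop] at this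

lemma ofNat_three_succ (i : ℕ) : Fin.ofNat 3 (i + 1) = Fin.ofNat 3 i + 1 := by
  ext; simp [Fin.ofNat, Fin.val_add]

lemma ofNat_three_add_three (i : ℕ) : Fin.ofNat 3 (i + 3) = Fin.ofNat 3 i := by
  ext; simp [Fin.ofNat]

lemma orthicSchedule_periodic (Δ : Affine.Triangle ℝ Plane) :
    IsPeriodic 3 (orthicSchedule Δ) := fun i => by
  rw [orthicSchedule, ofNat_three_add_three, ← orthicSchedule]

lemma orthicSchedule_visits (hΔ : Δ.AcuteAngled) (i : ℕ) :
    Visits Δ (orthicSchedule Δ) (Fin.ofNat 3 i) i := by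
  rw [Visits, orthicSchedule, altitudeFoot_eq_foot hΔ]
  exact foot_mem_oppEdge (isAcute_points hΔ) _

lemma orthicSchedule_feasible (hΔ : Δ.AcuteAngled) : IsFeasible Δ (orthicSchedule Δ) := by
  refine ⟨fun i => ⟨_, orthicSchedule_visits hΔ i⟩, fun δ k => ⟨3 * k + δ, by omega, ?_⟩⟩
  have h : Fin.ofNat 3 (3 * k + δ) = δ := by
    ext; simp [Fin.ofNat, Nat.mod_eq_of_lt δ.is_lt]
  have := orthicSchedule_visits hΔ (3 * k + δ)
  rwa [h] at this

lemma orthicSchedule_cyclic (hΔ : Δ.AcuteAngled) : IsCyclic Δ (orthicSchedule Δ) := by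
  refine ⟨fun i => Fin.ofNat 3 i, orthicSchedule_visits hΔ, ?_, ofNat_three_add_three⟩
  ext i
  fin_cases i <;> simp [Fin.ofNat]

lemma orthicPerimeter_eq (hΔ : Δ.AcuteAngled) : orthicPerimeter Δ = orthicLength Δ.points := by
  have hV := isAcute_points hΔ
  have h0 := dist_foot_foot hV 0
  have h1 := dist_foot_foot hV 1
  have h2 := dist_foot_foot hV 2
  simp only [zero_add, Fin.isValue, Fin.reduceAdd]
    at h0 h1 h2
  simp only [orthicPerimeter, altitudeFoot_eq_foot hΔ, h0, h1, h2, orthicLength,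
    Fin.sum_univ_three]
  ring

lemma travelTime_orthicSchedule (hΔ : Δ.AcuteAngled) (i : ℕ) :
    travelTime (orthicSchedule Δ) i (i + 3) = ENNReal.ofReal (orthicLength Δ.points) := by
  have hV := isAcute_points hΔ
  have hstep : ∀ j, dist (orthicSchedule Δ j) (orthicSchedule Δ (j + 1)) =
      side Δ.points (Fin.ofNat 3 j + 2) * cosAt Δ.points (Fin.ofNat 3 j + 2) := fun j => by
    rw [orthicSchedule, orthicSchedule, altitudeFoot_eq_foot hΔ, altitudeFoot_eq_foot hΔ,
      ofNat_three_succ, dist_foot_foot hV]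
  rw [travelTime_eq_ofReal, Finset.sum_Ico_eq_sum_range, add_tsub_cancel_left]
  congr 1
  simp only [Finset.sum_range_succ, Finset.sum_range_zero, zero_add, add_zero, hstep]
  rw [ofNat_three_succ, show i + 2 = i + 1 + 1 from rfl, ofNat_three_succ, ofNat_three_succ,
    fin3_add_one_add_one, fin3_add_one_add_two, fin3_add_two_add_two,
    orthicLength_eq _ (Fin.ofNat 3 i)]
  ring

/-- By periodicity consecutive visits are at most three steps apart, and three steps take exactly P.
The lower bound is the general one, applied to the orthic schedule. -/
lemma gap_orthicSchedule (hΔ : Δ.AcuteAngled) :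
    gap Δ (orthicSchedule Δ) 1 = ENNReal.ofReal (orthicLength Δ.points) := by
  refine le_antisymm (gap_le_of_travelTime_le (orthicSchedule_feasible hΔ) ?_)
    (orthicLength_le_gap hΔ (orthicSchedule_feasible hΔ))
  intro δ i j hij hi hj hno
  have hj3 : j ≤ i + 3 := by
    by_contra! h
    refine hno (i + 3) (by omega) h ?_
    rwa [Visits, orthicSchedule_periodic Δ i]
  rw [← travelTime_orthicSchedule hΔ i]
  exact Finset.sum_le_sum_of_subset (Finset.Ico_subset_Ico_right hj3)

end Schedules

end Patrolling

theorem theorem3 (Δ : Affine.Triangle ℝ Patrolling.Plane) (hΔ : Δ.AcuteAngled) :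
    Patrolling.IsFeasible Δ (Patrolling.orthicSchedule Δ) ∧
    Patrolling.IsCyclic Δ (Patrolling.orthicSchedule Δ) ∧
    Patrolling.IsPeriodic 3 (Patrolling.orthicSchedule Δ) ∧
    Patrolling.gap Δ (Patrolling.orthicSchedule Δ) 1 =
      ENNReal.ofReal (Patrolling.orthicPerimeter Δ) ∧
    ∀ s : ℕ → Patrolling.Plane, Patrolling.IsFeasible Δ s →
      Patrolling.gap Δ (Patrolling.orthicSchedule Δ) 1 ≤ Patrolling.gap Δ s 1 := by
  refine ⟨Patrolling.orthicSchedule_feasible hΔ, Patrolling.orthicSchedule_cyclic hΔ,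
    Patrolling.orthicSchedule_periodic Δ, ?_, fun s hs => ?_⟩
  · rw [Patrolling.gap_orthicSchedule hΔ, Patrolling.orthicPerimeter_eq hΔ]
  · rw [Patrolling.gap_orthicSchedule hΔ]
    exact Patrolling.orthicLength_le_gap hΔ hs
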